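/- Let $d\ge 0$, $n\ge 0$ be integers, let $\Gamma\subset\mathbb Z^d$ be a non-empty finite set with $D=|\Gamma|$ elements, and let $x_1,\dots,x_n$ be i.i.d. random variables uniformly distributed on $[0,1]^d$. Let $U$ be the random $n\times D$ Fourier matrix with entries $u_{tk}=e^{2\pi i\,k\cdot x_t}$ ($1\le t\le n$, $k\in\Gamma$), with the convention $n^{-1}U^*U=0$ for $n=0$. Let $\|\cdot\|$ be the operator norm with respect to the Euclidean norm on $\mathbb C^D$, let $\lambda_{\min},\lambda_{\max}$ be the smallest and largest eigenvalue of a Hermitian matrix, and let the condition number of a positive definite matrix be $\lambda_{\max}/\lambda_{\min}$. Let $0<\varepsilon<1$ and $\delta>0$. (a) Let $0<\alpha<\varepsilon^2$. If $$\left\lfloor\frac{\alpha n}{3D}\right\rfloor\ \ge\ \left[\ln\left(\frac{\varepsilon^2}{\alpha}\right)\right]^{-1}\ln\left(\frac{D}{\delta(1-\alpha)}\right),$$ then, with probability at least $1-\delta$, all of the following hold: $\|n^{-1}U^*U-I\|<\varepsilon$; $$1-\varepsilon<\lambda_{\min}(n^{-1}U^*U)\le\lambda_{\max}(n^{-1}U^*U)<1+\varepsilon;$$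 and $U^*U$ is positive definite with condition number at most $\frac{1+\varepsilon}{1-\varepsilon}$. (b) The conclusion of (a) also holds with probability at least $1-\delta$ whenever $$n\ \ge\ \frac{3De}{\varepsilon^2}\left[\ln\left(\frac D\delta\right)+2-\ln(e-1)\right].$$ (c) There is a constant $C>0$ depending only on $\varepsilon$ and $\delta$ (not on $d$, $n$ or $\Gamma$) such that, whenever $D\ge 2$ and $n\ge C\,D\ln D$, the conclusion of (a) holds with probability at least $1-\delta$. -/

import Mathlib

open MeasureTheory ProbabilityTheory

noncomputable section

namespace RandomFourier

/-- The Fourier matrix of the frequency set `Γ` and the points `x 0, …, x (n - 1)`: rows are indexed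
by the points, columns by `Γ`, and the entry at `(t, k)` is `exp (2 π i k · x t)`. -/
def fourierMatrix {d n : ℕ} (Γ : Finset (Fin d → ℤ)) (x : Fin n → Fin d → ℝ) :
    Matrix (Fin n) Γ ℂ :=
  Matrix.of fun t k =>
    Complex.exp (2 * Real.pi * Complex.I * ((∑ i, ((k : Fin d → ℤ) i : ℝ) * x t i : ℝ) : ℂ))

/-- The Gram matrix `U* U`. -/
def gram {d n : ℕ} (Γ : Finset (Fin d → ℤ)) (x : Fin n → Fin d → ℝ) : Matrix Γ Γ ℂ :=
  (fourierMatrix Γ x).conjTranspose * fourierMatrix Γ x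

/-- The normalized Gram matrix `n⁻¹ U* U`. -/
def normalizedGram {d n : ℕ} (Γ : Finset (Fin d → ℤ)) (x : Fin n → Fin d → ℝ) :
    Matrix Γ Γ ℂ :=
  (n : ℂ)⁻¹ • gram Γ x

/-- The operator norm of a square matrix with respect to the Euclidean norm. -/
def opNorm {ι : Type*} [Fintype ι] [DecidableEq ι] (A : Matrix ι ι ℂ) : ℝ :=
  ‖Matrix.toEuclideanCLM (n := ι) (𝕜 := ℂ) A‖

/-- The maximal eigenvalue of a Hermitian matrix (of positive size): its real spectrum is then
finite, non-empty and consists of all the eigenvalues. -/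
def lambdaMax {ι : Type*} [Fintype ι] [DecidableEq ι] (A : Matrix ι ι ℂ) : ℝ :=
  sSup (spectrum ℝ A)

/-- The minimal eigenvalue of a Hermitian matrix (of positive size). -/
def lambdaMin {ι : Type*} [Fintype ι] [DecidableEq ι] (A : Matrix ι ι ℂ) : ℝ :=
  sInf (spectrum ℝ A)

/-- The condition number `λ_max / λ_min` of a Hermitian positive definite matrix. -/
def condNumber {ι : Type*} [Fintype ι] [DecidableEq ι] (A : Matrix ι ι ℂ) : ℝ :=
  lambdaMax A / lambdaMin A

/-- The points `x` are i.i.d. random variables, uniformly distributed on `[0,1]^d`. -/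
structure IsUniformSample {Ω : Type*} [MeasurableSpace Ω] (μ : Measure Ω) {d n : ℕ}
    (x : Fin n → Ω → Fin d → ℝ) : Prop where
  measurable : ∀ t, Measurable (x t)
  indep : iIndepFun x μ
  uniform : ∀ t, pdf.IsUniform (x t) (Set.Icc (0 : Fin d → ℝ) 1) μ volume

/-- The outcome asserted for the points `x`: `‖n⁻¹ U* U - I‖ < ε`, the eigenvalues of `n⁻¹ U* U` lie
strictly between `1 - ε` and `1 + ε`, and `U* U` is positive definite with condition number at most
`(1 + ε) / (1 - ε)`. -/
def WellConditioned {d n : ℕ} (ε : ℝ) (Γ : Finset (Fin d → ℤ)) (x : Fin n → Fin d → ℝ) : Prop :=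
  opNorm (normalizedGram Γ x - 1) < ε ∧
  (1 - ε < lambdaMin (normalizedGram Γ x) ∧
    lambdaMin (normalizedGram Γ x) ≤ lambdaMax (normalizedGram Γ x) ∧
    lambdaMax (normalizedGram Γ x) < 1 + ε) ∧
  (0 < lambdaMin (gram Γ x) ∧ condNumber (gram Γ x) ≤ (1 + ε) / (1 - ε))

end RandomFourier

end

/-!
The Gram matrix `U* U` is a sum of `n` independent rank-one matrices, one for each sampling point;
each has spectrum in `[0, D]`, and orthonormality of the characters on the unit cube makes its mean
the identity. By the Golden–Thompson inequality and independence, each summand multiplies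
`E tr exp (θ U* U)` by at most `exp ((exp (θ D) - 1) / D)`, since the chord bound
`exp (θ x) ≤ 1 + (exp (θ D) - 1) / D * x` on `[0, D]` passes to matrices (Ahlswede–Winter). Markov's
inequality, with `θ = log (1 + ε) / D` and `θ = -ε / D`, then puts the spectrum of `U* U` inside
`((1 - ε) n, (1 + ε) n)` except with probability `2 D exp (-ε² n / (3 D))`, and each of the
conditions in (a), (b), (c) makes this at most `δ`.
-/

section LieProductFormula

open Filter Topology NormedSpace

theorem norm_pow_sub_pow_le {R : Type*} [SeminormedRing R] [NormOneClass R] {a b : R} {M : ℝ}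
    (ha : ‖a‖ ≤ M) (hb : ‖b‖ ≤ M) (n : ℕ) :
    ‖a ^ n - b ^ n‖ ≤ n * M ^ (n - 1) * ‖a - b‖ := by
  have hM : 0 ≤ M := (norm_nonneg _).trans ha
  induction n with
  | zero => simp
  | succ n ih =>
    have telescope : a ^ (n + 1) - b ^ (n + 1) = a * (a ^ n - b ^ n) + (a - b) * b ^ n := by
      rw [pow_succ' a, pow_succ' b]
      noncomm_ring
    have hbn : ‖b ^ n‖ ≤ M ^ n := (norm_pow_le _ _).trans (by gcongr)
    calc ‖a ^ (n + 1) - b ^ (n + 1)‖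
        ≤ ‖a‖ * ‖a ^ n - b ^ n‖ + ‖a - b‖ * ‖b ^ n‖ := by
          rw [telescope]
          exact norm_add_le_of_le (norm_mul_le _ _) (norm_mul_le _ _)
      _ ≤ M * (n * M ^ (n - 1) * ‖a - b‖) + ‖a - b‖ * M ^ n := by gcongr
      _ = (n + 1 : ℕ) * M ^ (n + 1 - 1) * ‖a - b‖ := by
          rcases n.eq_zero_or_pos with rfl | hn
          · simp
          · rw [Nat.add_sub_cancel, ← mul_pow_sub_one hn.ne' M]
            push_cast
            ring

variable {𝔸 : Type*} [NormedRing 𝔸] [NormedAlgebra ℝ 𝔸] [CompleteSpace 𝔸]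

theorem norm_exp_le_exp_norm [NormOneClass 𝔸] (x : 𝔸) : ‖exp x‖ ≤ Real.exp ‖x‖ := by
  have hseries : HasSum (fun n : ℕ => ‖x‖ ^ n / n.factorial) (Real.exp ‖x‖) := by
    rw [Real.exp_eq_exp_ℝ]
    exact expSeries_div_hasSum_exp ‖x‖
  rw [← (exp_series_hasSum_exp' (𝕂 := ℝ) x).tsum_eq]
  refine tsum_of_norm_bounded hseries fun n => ?_
  rw [norm_smul, norm_inv, Real.norm_natCast, div_eq_inv_mul]
  gcongr
  exact norm_pow_le _ _

theorem isLittleO_exp_smul_mul_exp_smul_sub (x y : 𝔸) :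
    (fun t : ℝ => exp (t • x) * exp (t • y) - exp (t • (x + y))) =o[𝓝 0] fun t : ℝ => t := by
  have hexp (z : 𝔸) : HasDerivAt (fun t : ℝ => exp (t • z)) z 0 := by
    simpa using hasDerivAt_exp_smul_const (𝕂 := ℝ) z (0 : ℝ)
  have hderiv := ((hexp x).mul (hexp y)).sub (hexp (x + y))
  simp only [zero_smul, exp_zero, mul_one, one_mul, sub_self] at hderiv
  simpa using hasDerivAt_iff_isLittleO.1 hderiv

theorem exp_inv_smul_pow (x : 𝔸) {n : ℕ} (hn : n ≠ 0) : exp ((n : ℝ)⁻¹ • x) ^ n = exp x := by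
  let _ : NormedAlgebra ℚ 𝔸 := NormedAlgebra.restrictScalars ℚ ℝ 𝔸
  rw [← exp_nsmul, ← Nat.cast_smul_eq_nsmul ℝ, smul_inv_smul₀ (Nat.cast_ne_zero.2 hn)]

variable [NormOneClass 𝔸]

theorem norm_exp_mul_exp_pow_sub_exp_add_le (x y : 𝔸) {n : ℕ} (hn : n ≠ 0) :
    ‖(exp ((n : ℝ)⁻¹ • x) * exp ((n : ℝ)⁻¹ • y)) ^ n - exp (x + y)‖ ≤
      Real.exp (‖x‖ + ‖y‖) *
        (n * ‖exp ((n : ℝ)⁻¹ • x) * exp ((n : ℝ)⁻¹ • y) - exp ((n : ℝ)⁻¹ • (x + y))‖) := by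
  set r : ℝ := (n : ℝ)⁻¹
  set M : ℝ := Real.exp (r * (‖x‖ + ‖y‖)) with hM
  have hr : 0 ≤ r := by positivity
  have hexp (z : 𝔸) : ‖exp (r • z)‖ ≤ Real.exp (r * ‖z‖) := by
    simpa only [norm_smul, Real.norm_of_nonneg hr] using norm_exp_le_exp_norm (r • z)
  have hmul : ‖exp (r • x) * exp (r • y)‖ ≤ M := by
    rw [hM, mul_add, Real.exp_add]
    exact norm_mul_le_of_le (hexp x) (hexp y)
  have hadd : ‖exp (r • (x + y))‖ ≤ M :=
    (hexp _).trans (Real.exp_le_exp.2 (by gcongr; exact norm_add_le _ _))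
  have hMpow : M ^ (n - 1) ≤ Real.exp (‖x‖ + ‖y‖) := by
    calc M ^ (n - 1) ≤ M ^ n :=
          pow_le_pow_right₀ (Real.one_le_exp (by positivity)) (Nat.sub_le n 1)
      _ = Real.exp (‖x‖ + ‖y‖) := by
          rw [hM, ← Real.exp_nat_mul, mul_inv_cancel_left₀ (Nat.cast_ne_zero.2 hn)]
  rw [← exp_inv_smul_pow (x + y) hn]
  refine (norm_pow_sub_pow_le hmul hadd n).trans ?_
  rw [mul_comm (n : ℝ), mul_assoc]
  gcongr

/-- The **Lie product formula**. -/
theorem tendsto_exp_mul_exp_pow (x y : 𝔸) :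
    Tendsto (fun n : ℕ => (exp ((n : ℝ)⁻¹ • x) * exp ((n : ℝ)⁻¹ • y)) ^ n) atTop
      (𝓝 (exp (x + y))) := by
  have hratio := ((isLittleO_exp_smul_mul_exp_smul_sub x y).comp_tendsto
    tendsto_inv_atTop_nhds_zero_nat).norm_norm.tendsto_div_nhds_zero
  have hbound := hratio.const_mul (Real.exp (‖x‖ + ‖y‖))
  rw [mul_zero] at hbound
  rw [tendsto_iff_norm_sub_tendsto_zero]
  refine squeeze_zero' (Eventually.of_forall fun _ => norm_nonneg _) ?_ hbound
  filter_upwards [eventually_ne_atTop 0] with n hn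
  refine (norm_exp_mul_exp_pow_sub_exp_add_le x y hn).trans_eq ?_
  simp only [Function.comp_apply, norm_inv, Real.norm_natCast, div_inv_eq_mul, mul_comm]

end LieProductFormula

section GoldenThompson

open Filter Topology NormedSpace Matrix
open scoped Matrix.Norms.Operator

variable {𝕜 ι : Type*} [RCLike 𝕜] [Fintype ι]

theorem trace_mul_conjTranspose_self_eq_sum_norm_sq (X : Matrix ι ι 𝕜) :
    (X * Xᴴ).trace = ((∑ i, ∑ j, ‖X i j‖ ^ 2 : ℝ) : 𝕜) := by
  simp [Matrix.trace, Matrix.mul_apply, RCLike.mul_conj]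

theorem two_mul_norm_trace_mul_le (X Y : Matrix ι ι 𝕜) :
    2 * ‖(X * Y).trace‖ ≤ ‖(X * Xᴴ).trace‖ + ‖(Y * Yᴴ).trace‖ := by
  have hnorm (Z : Matrix ι ι 𝕜) : ∑ i, ∑ j, ‖Z i j‖ ^ 2 ≤ ‖(Z * Zᴴ).trace‖ := by
    rw [trace_mul_conjTranspose_self_eq_sum_norm_sq, RCLike.norm_ofReal]
    exact le_abs_self _
  calc 2 * ‖(X * Y).trace‖
      ≤ 2 * ∑ i, ∑ j, ‖X i j‖ * ‖Y j i‖ := by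
        simp only [Matrix.trace, Matrix.diag_apply, Matrix.mul_apply]
        gcongr
        exact norm_sum_le_of_le _ fun i _ => norm_sum_le_of_le _ fun j _ => norm_mul_le _ _
    _ ≤ ∑ i, ∑ j, (‖X i j‖ ^ 2 + ‖Y j i‖ ^ 2) := by
        simp only [Finset.mul_sum, ← mul_assoc]
        gcongr
        exact two_mul_le_add_sq _ _
    _ = ∑ i, ∑ j, ‖X i j‖ ^ 2 + ∑ i, ∑ j, ‖Y i j‖ ^ 2 := by
        simp only [Finset.sum_add_distrib]
        rw [Finset.sum_comm (f := fun i j => ‖Y j i‖ ^ 2)]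
    _ ≤ _ := add_le_add (hnorm X) (hnorm Y)

variable [DecidableEq ι]

theorem trace_mul_pow_comm {R : Type*} [CommRing R] (X Y : Matrix ι ι R) (n : ℕ) :
    ((X * Y) ^ n).trace = ((Y * X) ^ n).trace := by
  cases n with
  | zero => simp
  | succ n =>
    rw [pow_succ, ← mul_assoc, mul_pow_mul, mul_assoc, Matrix.trace_mul_comm, mul_assoc, ← pow_succ]

theorem norm_trace_pow_two_pow_succ_le {k : ℕ}
    (hsq : ∀ M : Matrix ι ι 𝕜, ‖(M ^ 2 ^ (k + 1)).trace‖ ≤ ‖((M * Mᴴ) ^ 2 ^ k).trace‖)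
    (hmul : ∀ A B : Matrix ι ι 𝕜, A.IsHermitian → B.IsHermitian →
      ‖((A * B) ^ 2 ^ k).trace‖ ≤ ‖(A ^ 2 ^ k * B ^ 2 ^ k).trace‖) (M : Matrix ι ι 𝕜) :
    ‖(M ^ 2 ^ (k + 2)).trace‖ ≤ ‖((M * Mᴴ) ^ 2 ^ (k + 1)).trace‖ := by
  have hA : (Mᴴ * M).IsHermitian := isHermitian_conjTranspose_mul_self M
  have hB : (M * Mᴴ).IsHermitian := isHermitian_mul_conjTranspose_self M
  have hcyclic : (((M ^ 2) * (M ^ 2)ᴴ) ^ 2 ^ k).trace = ((Mᴴ * M * (M * Mᴴ)) ^ 2 ^ k).trace := by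
    rw [show M ^ 2 * (M ^ 2)ᴴ = M * M * Mᴴ * Mᴴ by rw [conjTranspose_pow]; noncomm_ring,
      trace_mul_pow_comm]
    simp only [mul_assoc]
  have hcauchy := two_mul_norm_trace_mul_le ((Mᴴ * M) ^ 2 ^ k) ((M * Mᴴ) ^ 2 ^ k)
  rw [(hA.pow _).eq, (hB.pow _).eq, ← pow_add, ← pow_add, ← two_mul, ← pow_succ',
    trace_mul_pow_comm Mᴴ M] at hcauchy
  calc ‖(M ^ 2 ^ (k + 2)).trace‖ = ‖((M ^ 2) ^ 2 ^ (k + 1)).trace‖ := by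
        rw [← pow_mul, ← pow_succ']
    _ ≤ ‖((Mᴴ * M * (M * Mᴴ)) ^ 2 ^ k).trace‖ := (hsq (M ^ 2)).trans_eq (by rw [hcyclic])
    _ ≤ ‖((Mᴴ * M) ^ 2 ^ k * (M * Mᴴ) ^ 2 ^ k).trace‖ := hmul _ _ hA hB
    _ ≤ ‖((M * Mᴴ) ^ 2 ^ (k + 1)).trace‖ := by linarith

theorem norm_trace_mul_pow_two_pow_succ_le {k : ℕ}
    (hsq : ∀ M : Matrix ι ι 𝕜, ‖(M ^ 2 ^ (k + 1)).trace‖ ≤ ‖((M * Mᴴ) ^ 2 ^ k).trace‖)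
    (hmul : ∀ A B : Matrix ι ι 𝕜, A.IsHermitian → B.IsHermitian →
      ‖((A * B) ^ 2 ^ k).trace‖ ≤ ‖(A ^ 2 ^ k * B ^ 2 ^ k).trace‖)
    {A B : Matrix ι ι 𝕜} (hA : A.IsHermitian) (hB : B.IsHermitian) :
    ‖((A * B) ^ 2 ^ (k + 1)).trace‖ ≤ ‖(A ^ 2 ^ (k + 1) * B ^ 2 ^ (k + 1)).trace‖ := by
  calc ‖((A * B) ^ 2 ^ (k + 1)).trace‖ ≤ ‖((A * (B * B * A)) ^ 2 ^ k).trace‖ := by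
        simpa only [conjTranspose_mul, hA.eq, hB.eq, mul_assoc] using hsq (A * B)
    _ = ‖((A ^ 2 * B ^ 2) ^ 2 ^ k).trace‖ := by
        rw [trace_mul_pow_comm, mul_assoc, trace_mul_pow_comm, pow_two, pow_two]
    _ ≤ ‖((A ^ 2) ^ 2 ^ k * (B ^ 2) ^ 2 ^ k).trace‖ := hmul _ _ (hA.pow 2) (hB.pow 2)
    _ = ‖(A ^ 2 ^ (k + 1) * B ^ 2 ^ (k + 1)).trace‖ := by
        rw [← pow_mul, ← pow_mul, ← pow_succ']

theorem norm_trace_mul_pow_two_pow_le {A B : Matrix ι ι 𝕜} (hA : A.IsHermitian)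
    (hB : B.IsHermitian) (k : ℕ) :
    ‖((A * B) ^ 2 ^ k).trace‖ ≤ ‖(A ^ 2 ^ k * B ^ 2 ^ k).trace‖ := by
  suffices h : (∀ M : Matrix ι ι 𝕜, ‖(M ^ 2 ^ (k + 1)).trace‖ ≤ ‖((M * Mᴴ) ^ 2 ^ k).trace‖) ∧
      ∀ A B : Matrix ι ι 𝕜, A.IsHermitian → B.IsHermitian →
        ‖((A * B) ^ 2 ^ k).trace‖ ≤ ‖(A ^ 2 ^ k * B ^ 2 ^ k).trace‖ from h.2 A B hA hB
  clear hA hB A B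
  -- The square bound at level `k + 1` applies the product bound to `Mᴴ * M` and `M * Mᴴ`; the
  -- product bound at level `k + 1` applies the square bound to `A * B`.
  induction k with
  | zero =>
    refine ⟨fun M => ?_, fun A B _ _ => by simp⟩
    have hcauchy := two_mul_norm_trace_mul_le M M
    simp only [zero_add, pow_one, pow_zero, pow_two]
    linarith
  | succ k ih =>
    exact ⟨norm_trace_pow_two_pow_succ_le ih.1 ih.2,
      fun _ _ => norm_trace_mul_pow_two_pow_succ_le ih.1 ih.2⟩

theorem norm_trace_exp_add_le {A B : Matrix ι ι 𝕜} (hA : A.IsHermitian) (hB : B.IsHermitian) :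
    ‖(exp (A + B)).trace‖ ≤ ‖(exp A * exp B).trace‖ := by
  cases isEmpty_or_nonempty ι
  · simp [Matrix.trace]
  have hlim := (tendsto_exp_mul_exp_pow A B).comp (tendsto_pow_atTop_atTop_of_one_lt one_lt_two)
  have hcont : Continuous fun Z : Matrix ι ι 𝕜 => ‖Z.trace‖ :=
    continuous_norm.comp continuous_id.matrix_trace
  refine le_of_tendsto ((hcont.tendsto _).comp hlim) (Eventually.of_forall fun k => ?_)
  have hherm {Z : Matrix ι ι 𝕜} (hZ : Z.IsHermitian) :
      (exp (((2 ^ k : ℕ) : ℝ)⁻¹ • Z)).IsHermitian := (hZ.smul (.all _)).exp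
  have hpow (Z : Matrix ι ι 𝕜) : exp (((2 ^ k : ℕ) : ℝ)⁻¹ • Z) ^ 2 ^ k = exp Z :=
    exp_inv_smul_pow Z (by positivity)
  have h := norm_trace_mul_pow_two_pow_le (hherm hA) (hherm hB) k
  rw [hpow, hpow] at h
  exact h

end GoldenThompson

section TraceExp

open NormedSpace Matrix
open scoped Matrix.Norms.Operator MatrixOrder ComplexOrder

variable {𝕜 ι : Type*} [RCLike 𝕜] [Fintype ι]

theorem trace_mul_nonneg_of_nonneg {P A : Matrix ι ι 𝕜} (hP : 0 ≤ P) (hA : 0 ≤ A) :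
    0 ≤ (P * A).trace := by
  classical
  obtain ⟨Y, rfl⟩ := CStarAlgebra.nonneg_iff_eq_star_mul_self.1 hP
  rw [mul_assoc, Matrix.trace_mul_comm]
  exact (hA.posSemidef.mul_mul_conjTranspose_same Y).trace_nonneg

theorem trace_mul_le_trace_mul_of_nonneg {P A B : Matrix ι ι 𝕜} (hP : 0 ≤ P) (hAB : A ≤ B) :
    (P * A).trace ≤ (P * B).trace := by
  rw [← sub_nonneg, ← Matrix.trace_sub, ← mul_sub]
  exact trace_mul_nonneg_of_nonneg hP (sub_nonneg.2 hAB)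

variable [DecidableEq ι]

theorem exp_nonneg_of_isHermitian {A : Matrix ι ι 𝕜} (hA : A.IsHermitian) : 0 ≤ exp A := by
  have hhalf : exp A = (exp ((2 : ℝ)⁻¹ • A))ᴴ * exp ((2 : ℝ)⁻¹ • A) := by
    rw [(hA.smul (.all (2 : ℝ)⁻¹)).exp.eq, ← pow_two]
    exact_mod_cast (exp_inv_smul_pow A two_ne_zero).symm
  rw [hhalf]
  exact (posSemidef_conjTranspose_mul_self _).nonneg

/-- The **Golden–Thompson inequality**. -/
theorem trace_exp_add_le {A B : Matrix ι ι 𝕜} (hA : A.IsHermitian) (hB : B.IsHermitian) :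
    (exp (A + B)).trace ≤ (exp A * exp B).trace := by
  have hsum : 0 ≤ (exp (A + B)).trace :=
    (exp_nonneg_of_isHermitian (hA.add hB)).posSemidef.trace_nonneg
  have hprod : 0 ≤ (exp A * exp B).trace :=
    trace_mul_nonneg_of_nonneg (exp_nonneg_of_isHermitian hA) (exp_nonneg_of_isHermitian hB)
  rw [← RCLike.norm_of_nonneg' hsum, ← RCLike.norm_of_nonneg' hprod, RCLike.ofReal_le_ofReal]
  exact norm_trace_exp_add_le hA hB

end TraceExp

section SpectralBounds

open NormedSpace Matrix
open scoped Matrix.Norms.L2Operator MatrixOrder ComplexOrder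

theorem exp_smul_eq_cfc {A : Type*} [NormedRing A] [StarRing A] [NormedAlgebra ℝ A]
    [StarModule ℝ A] [ContinuousFunctionalCalculus ℝ A IsSelfAdjoint] {a : A}
    (ha : IsSelfAdjoint a) (θ : ℝ) : exp (θ • a) = cfc (fun x => Real.exp (θ * x)) a := by
  rw [← CFC.real_exp_eq_normedSpace_exp ((IsSelfAdjoint.all θ).smul ha),
    ← cfc_comp_smul θ Real.exp a]
  rfl

theorem exp_mul_le_one_add_mul {R : ℝ} (hR : 0 < R) (θ : ℝ) {x : ℝ} (hx : x ∈ Set.Icc 0 R) :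
    Real.exp (θ * x) ≤ 1 + (Real.exp (θ * R) - 1) / R * x := by
  have hchord := convexOn_exp.2 (Set.mem_univ 0) (Set.mem_univ (θ * R))
    (sub_nonneg.2 (div_le_one_of_le₀ hx.2 hR.le)) (div_nonneg hx.1 hR.le) (sub_add_cancel 1 _)
  simp only [smul_eq_mul, mul_zero, zero_add, Real.exp_zero, mul_one] at hchord
  calc Real.exp (θ * x) = Real.exp (x / R * (θ * R)) := by congr 1; field_simp
    _ ≤ 1 - x / R + x / R * Real.exp (θ * R) := hchord
    _ = _ := by ring

variable {ι : Type*} [Fintype ι]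

/-- The real part of the trace, as a continuous linear functional. -/
noncomputable def reTrace : Matrix ι ι ℂ →L[ℝ] ℝ :=
  LinearMap.toContinuousLinearMap (Complex.reLm ∘ₗ Matrix.traceLinearMap ι ℝ ℂ)

theorem reTrace_apply (A : Matrix ι ι ℂ) : reTrace A = A.trace.re := rfl

variable [DecidableEq ι]

theorem exp_smul_le_one_add_smul {A : Matrix ι ι ℂ} (hA : A.IsHermitian) {R : ℝ} (hR : 0 < R)
    (hspec : spectrum ℝ A ⊆ Set.Icc 0 R) (θ : ℝ) :
    exp (θ • A) ≤ 1 + ((Real.exp (θ * R) - 1) / R) • A := by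
  have hA : IsSelfAdjoint A := hA
  calc exp (θ • A) = cfc (fun x => Real.exp (θ * x)) A := exp_smul_eq_cfc hA θ
    _ ≤ cfc (fun x => 1 + (Real.exp (θ * R) - 1) / R * x) A :=
      cfc_mono fun x hx => exp_mul_le_one_add_mul hR θ (hspec hx)
    _ = 1 + ((Real.exp (θ * R) - 1) / R) • A := by
      rw [cfc_const_add .., cfc_const_mul_id .., map_one]

theorem reTrace_one : reTrace (1 : Matrix ι ι ℂ) = Fintype.card ι := by
  simp [reTrace_apply]

theorem le_reTrace_of_mem_spectrum {A : Matrix ι ι ℂ} (hA : 0 ≤ A) {r : ℝ}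
    (hr : r ∈ spectrum ℝ A) : r ≤ reTrace A := by
  have hpsd := hA.posSemidef
  rw [hpsd.isHermitian.spectrum_real_eq_range_eigenvalues] at hr
  obtain ⟨i, rfl⟩ := hr
  rw [reTrace_apply, hpsd.isHermitian.trace_eq_sum_eigenvalues, ← RCLike.ofReal_sum]
  exact Finset.single_le_sum (fun j _ => hpsd.eigenvalues_nonneg j) (Finset.mem_univ i)

theorem exp_mul_le_reTrace_exp_smul {A : Matrix ι ι ℂ} (hA : A.IsHermitian) {r : ℝ}
    (hr : r ∈ spectrum ℝ A) (θ : ℝ) : Real.exp (θ * r) ≤ reTrace (exp (θ • A)) := by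
  refine le_reTrace_of_mem_spectrum (exp_nonneg_of_isHermitian (hA.smul (.all θ))) ?_
  have hA : IsSelfAdjoint A := hA
  rw [exp_smul_eq_cfc hA, cfc_map_spectrum ..]
  exact ⟨r, hr, rfl⟩

theorem reTrace_exp_nonneg {A : Matrix ι ι ℂ} (hA : A.IsHermitian) : 0 ≤ reTrace (exp A) :=
  (Complex.le_def.1 (exp_nonneg_of_isHermitian hA).posSemidef.trace_nonneg).1

theorem reTrace_exp_add_smul_le {A B : Matrix ι ι ℂ} (hA : A.IsHermitian) (hB : B.IsHermitian)
    {R : ℝ} (hR : 0 < R) (hspec : spectrum ℝ B ⊆ Set.Icc 0 R) (θ : ℝ) :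
    reTrace (exp (A + θ • B)) ≤
      reTrace (exp A) + (Real.exp (θ * R) - 1) / R * reTrace (exp A * B) := by
  have htrace : (exp (A + θ • B)).trace ≤
      (exp A * (1 + ((Real.exp (θ * R) - 1) / R) • B)).trace :=
    (trace_exp_add_le hA (hB.smul (.all θ))).trans
      (trace_mul_le_trace_mul_of_nonneg (exp_nonneg_of_isHermitian hA)
        (exp_smul_le_one_add_smul hB hR hspec θ))
  calc reTrace (exp (A + θ • B))
      ≤ reTrace (exp A * (1 + ((Real.exp (θ * R) - 1) / R) • B)) :=
        (Complex.le_def.1 htrace).1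
    _ = _ := by rw [mul_add, mul_one, mul_smul_comm, map_add, map_smul, smul_eq_mul]

end SpectralBounds

section MatrixChernoff

open NormedSpace
open scoped Matrix.Norms.L2Operator

theorem norm_le_of_spectrum_subset_Icc {A : Type*} [CStarAlgebra A] [Nontrivial A] {a : A}
    (ha : IsSelfAdjoint a) {R : ℝ} (hspec : spectrum ℝ a ⊆ Set.Icc 0 R) : ‖a‖ ≤ R := by
  rcases CStarAlgebra.norm_or_neg_norm_mem_spectrum ha with hnorm | hneg
  · exact (hspec hnorm).2
  · linarith [(hspec hneg).1, (hspec hneg).2, norm_nonneg a]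

theorem continuous_exp_smul {𝔸 : Type*} [NormedRing 𝔸] [NormedAlgebra ℝ 𝔸] [CompleteSpace 𝔸]
    (θ : ℝ) : Continuous fun a : 𝔸 => exp (θ • a) :=
  let _ : NormedAlgebra ℚ 𝔸 := NormedAlgebra.restrictScalars ℚ ℝ 𝔸
  exp_continuous.comp (continuous_const_smul θ)

theorem add_sq_div_three_le_mul_log {ε : ℝ} (hε : 0 ≤ ε) (hε1 : ε ≤ 1) :
    ε + ε ^ 2 / 3 ≤ (1 + ε) * Real.log (1 + ε) := by
  calc ε + ε ^ 2 / 3 ≤ (1 + ε) * (2 * ε / (ε + 2)) := by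
        rw [mul_div_assoc', le_div_iff₀ (by linarith)]
        nlinarith [mul_nonneg (sq_nonneg ε) (sub_nonneg.2 hε1)]
    _ ≤ _ := by
        gcongr
        exact Real.le_log_one_add_of_nonneg hε

theorem exp_neg_le_one_sub_add_sq_div_two {ε : ℝ} (hε : 0 ≤ ε) :
    Real.exp (-ε) ≤ 1 - ε + ε ^ 2 / 2 := by
  have hpos : 0 < 1 - ε + ε ^ 2 / 2 := by nlinarith [sq_nonneg (ε - 1)]
  rw [Real.exp_neg, inv_le_iff_one_le_mul₀ (Real.exp_pos ε)]
  calc 1 ≤ (1 - ε + ε ^ 2 / 2) * (1 + ε + ε ^ 2 / 2) := by nlinarith [sq_nonneg (ε ^ 2)]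
    _ ≤ _ := by
        gcongr
        exact Real.quadratic_le_exp_of_nonneg hε

variable {κ Ω ι : Type*} [Fintype ι] [DecidableEq ι] [MeasurableSpace (Matrix ι ι ℂ)]
  [MeasurableSpace Ω]

/-- The setting of the matrix Chernoff bound: independent, uniformly bounded, positive semidefinite
random matrices whose common mean is the identity. Boundedness and positivity are encoded together,
by confining the spectra to `[0, R]`. -/
structure IsIsotropicFamily (X : κ → Ω → Matrix ι ι ℂ) (R : ℝ) (μ : Measure Ω) : Prop where
  measurable : ∀ t, Measurable (X t)
  indep : iIndepFun X μ
  isHermitian : ∀ t ω, (X t ω).IsHermitian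
  bound_pos : 0 < R
  spectrum_subset : ∀ t ω, spectrum ℝ (X t ω) ⊆ Set.Icc 0 R
  integral_eq_one : ∀ t, ∫ ω, X t ω ∂μ = 1

namespace IsIsotropicFamily

variable {X : κ → Ω → Matrix ι ι ℂ} {R : ℝ} {μ : Measure Ω}

theorem isHermitian_sum (hX : IsIsotropicFamily X R μ) (s : Finset κ) (ω : Ω) :
    (∑ t ∈ s, X t ω).IsHermitian :=
  isSelfAdjoint_sum s fun t _ => hX.isHermitian t ω

variable [BorelSpace (Matrix ι ι ℂ)]

theorem measurable_sum (hX : IsIsotropicFamily X R μ) (s : Finset κ) :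
    Measurable fun ω => ∑ t ∈ s, X t ω :=
  Finset.measurable_fun_sum s fun t _ => hX.measurable t

theorem integrable_comp_sum [IsFiniteMeasure μ] [Nonempty ι] (hX : IsIsotropicFamily X R μ)
    (s : Finset κ) {f : Matrix ι ι ℂ → Matrix ι ι ℂ} (hf : Continuous f) :
    Integrable (fun ω => f (∑ t ∈ s, X t ω)) μ := by
  have hsum (ω : Ω) : ‖∑ t ∈ s, X t ω‖ ≤ s.card * R := by
    refine (norm_sum_le_of_le s fun t _ => norm_le_of_spectrum_subset_Icc
      (hX.isHermitian t ω) (hX.spectrum_subset t ω)).trans_eq ?_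
    rw [Finset.sum_const, nsmul_eq_mul]
  obtain ⟨C, hC⟩ := ((isCompact_closedBall (0 : Matrix ι ι ℂ) (s.card * R)).image hf).isBounded
    |>.exists_norm_le
  refine Integrable.of_bound (hf.measurable.comp (hX.measurable_sum s)).aestronglyMeasurable C
    (.of_forall fun ω => hC _ ⟨_, ?_, rfl⟩)
  exact mem_closedBall_zero_iff.2 (hsum ω)

theorem integrable [IsFiniteMeasure μ] [Nonempty ι] (hX : IsIsotropicFamily X R μ) (t : κ) :
    Integrable (X t) μ := by
  simpa using hX.integrable_comp_sum {t} continuous_id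

theorem integrable_reTrace_exp_smul_sum [IsFiniteMeasure μ] [Nonempty ι]
    (hX : IsIsotropicFamily X R μ) (s : Finset κ) (θ : ℝ) :
    Integrable (fun ω => reTrace (exp (θ • ∑ t ∈ s, X t ω))) μ :=
  reTrace.integrable_comp (hX.integrable_comp_sum s (continuous_exp_smul θ))

theorem indepFun_exp_smul_sum (hX : IsIsotropicFamily X R μ) {s : Finset κ} {t : κ} (ht : t ∉ s)
    (θ : ℝ) : IndepFun (fun ω => exp (θ • ∑ u ∈ s, X u ω)) (X t) μ := by
  have h := (hX.indep.indepFun_finsetSum_of_notMem hX.measurable ht).comp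
    (continuous_exp_smul θ).measurable measurable_id
  simpa only [Function.comp_def, Finset.sum_apply, id_eq] using h

theorem integrable_and_integral_reTrace_exp_smul_sum_mul [IsFiniteMeasure μ] [Nonempty ι]
    (hX : IsIsotropicFamily X R μ) {s : Finset κ} {t : κ} (ht : t ∉ s) (θ : ℝ) :
    Integrable (fun ω => reTrace (exp (θ • ∑ u ∈ s, X u ω) * X t ω)) μ ∧
      ∫ ω, reTrace (exp (θ • ∑ u ∈ s, X u ω) * X t ω) ∂μ =
        ∫ ω, reTrace (exp (θ • ∑ u ∈ s, X u ω)) ∂μ := by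
  have hexp := hX.integrable_comp_sum s (continuous_exp_smul θ)
  have hindep := hX.indepFun_exp_smul_sum ht θ
  have hmul := hindep.integrable_bilin hexp (hX.integrable t)
    (ContinuousLinearMap.mul ℝ (Matrix ι ι ℂ))
  refine ⟨reTrace.integrable_comp hmul, (reTrace.integral_comp_comm hmul).trans ?_⟩
  rw [reTrace.integral_comp_comm hexp, hindep.integral_bilin hexp (hX.integrable t),
    hX.integral_eq_one, ContinuousLinearMap.mul_apply', mul_one]

theorem integral_reTrace_exp_smul_sum_insert_le [IsFiniteMeasure μ] [Nonempty ι] [DecidableEq κ]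
    (hX : IsIsotropicFamily X R μ) {s : Finset κ} {t : κ} (ht : t ∉ s) (θ : ℝ) :
    ∫ ω, reTrace (exp (θ • ∑ u ∈ insert t s, X u ω)) ∂μ ≤
      Real.exp ((Real.exp (θ * R) - 1) / R) * ∫ ω, reTrace (exp (θ • ∑ u ∈ s, X u ω)) ∂μ := by
  set σ : ℝ := (Real.exp (θ * R) - 1) / R
  have hherm (ω : Ω) : (θ • ∑ u ∈ s, X u ω).IsHermitian := (hX.isHermitian_sum s ω).smul (.all θ)
  have hint := hX.integrable_reTrace_exp_smul_sum s θ
  obtain ⟨hint_mul, hmul⟩ := hX.integrable_and_integral_reTrace_exp_smul_sum_mul ht θ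
  calc ∫ ω, reTrace (exp (θ • ∑ u ∈ insert t s, X u ω)) ∂μ
      ≤ ∫ ω, (reTrace (exp (θ • ∑ u ∈ s, X u ω)) +
          σ * reTrace (exp (θ • ∑ u ∈ s, X u ω) * X t ω)) ∂μ := by
        refine integral_mono (hX.integrable_reTrace_exp_smul_sum _ θ)
          (hint.add (hint_mul.const_mul σ)) fun ω => ?_
        simp only [Finset.sum_insert ht, smul_add, add_comm (θ • X t ω)]
        exact reTrace_exp_add_smul_le (hherm ω) (hX.isHermitian t ω) hX.bound_pos
          (hX.spectrum_subset t ω) θ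
    _ = (σ + 1) * ∫ ω, reTrace (exp (θ • ∑ u ∈ s, X u ω)) ∂μ := by
        rw [integral_add hint (hint_mul.const_mul σ), integral_const_mul, hmul]
        ring
    _ ≤ Real.exp σ * ∫ ω, reTrace (exp (θ • ∑ u ∈ s, X u ω)) ∂μ := by
        gcongr
        · exact integral_nonneg fun ω => reTrace_exp_nonneg (hherm ω)
        · exact Real.add_one_le_exp σ

theorem integral_reTrace_exp_smul_sum_le [IsProbabilityMeasure μ] [Nonempty ι]
    (hX : IsIsotropicFamily X R μ) (s : Finset κ) (θ : ℝ) :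
    ∫ ω, reTrace (exp (θ • ∑ t ∈ s, X t ω)) ∂μ ≤
      Fintype.card ι * Real.exp (s.card * ((Real.exp (θ * R) - 1) / R)) := by
  classical
  induction s using Finset.induction_on with
  | empty => simp [reTrace_one]
  | insert t s ht ih =>
    calc _ ≤ Real.exp ((Real.exp (θ * R) - 1) / R) *
          (Fintype.card ι * Real.exp (s.card * ((Real.exp (θ * R) - 1) / R))) :=
        (hX.integral_reTrace_exp_smul_sum_insert_le ht θ).trans (by gcongr)
      _ = _ := by
        rw [mul_left_comm, ← Real.exp_add, Finset.card_insert_of_notMem ht]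
        push_cast
        ring_nf

theorem measureReal_exists_mem_spectrum_sum_le [IsProbabilityMeasure μ] [Nonempty ι]
    (hX : IsIsotropicFamily X R μ) (s : Finset κ) (θ a : ℝ) :
    μ.real {ω | ∃ r ∈ spectrum ℝ (∑ t ∈ s, X t ω), a ≤ θ * r} ≤
      Fintype.card ι * Real.exp (s.card * ((Real.exp (θ * R) - 1) / R) - a) := by
  have hmarkov := mul_meas_ge_le_integral_of_nonneg (μ := μ)
    (.of_forall fun ω => reTrace_exp_nonneg ((hX.isHermitian_sum s ω).smul (.all θ)))
    (hX.integrable_reTrace_exp_smul_sum s θ) (Real.exp a)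
  have hsub : {ω | ∃ r ∈ spectrum ℝ (∑ t ∈ s, X t ω), a ≤ θ * r} ⊆
      {ω | Real.exp a ≤ reTrace (exp (θ • ∑ t ∈ s, X t ω))} := by
    rintro ω ⟨r, hr, har⟩
    exact (Real.exp_le_exp.2 har).trans (exp_mul_le_reTrace_exp_smul (hX.isHermitian_sum s ω) hr θ)
  rw [Real.exp_sub, ← mul_div_assoc, le_div_iff₀' (Real.exp_pos a)]
  calc _ ≤ Real.exp a * μ.real {ω | Real.exp a ≤ reTrace (exp (θ • ∑ t ∈ s, X t ω))} := by
        gcongr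
        finiteness
    _ ≤ _ := hmarkov.trans (hX.integral_reTrace_exp_smul_sum_le s θ)

theorem measureReal_upper_tail_le [IsProbabilityMeasure μ] [Nonempty ι]
    (hX : IsIsotropicFamily X R μ) (s : Finset κ) {ε : ℝ} (hε : 0 ≤ ε) (hε1 : ε ≤ 1) :
    μ.real {ω | ∃ r ∈ spectrum ℝ (∑ t ∈ s, X t ω), (1 + ε) * s.card ≤ r} ≤
      Fintype.card ι * Real.exp (-(ε ^ 2 * s.card / (3 * R))) := by
  have hR := hX.bound_pos
  set θ := Real.log (1 + ε) / R with hθ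
  have hθR : Real.exp (θ * R) = 1 + ε := by
    rw [hθ, div_mul_cancel₀ _ hR.ne', Real.exp_log (by linarith)]
  have hθ0 : 0 ≤ θ := div_nonneg (Real.log_nonneg (by linarith)) hR.le
  calc _ ≤ μ.real {ω | ∃ r ∈ spectrum ℝ (∑ t ∈ s, X t ω), θ * ((1 + ε) * s.card) ≤ θ * r} :=
        measureReal_mono fun _ => Exists.imp fun _ => .imp_right (mul_le_mul_of_nonneg_left · hθ0)
    _ ≤ Fintype.card ι * Real.exp (s.card * ((1 + ε - 1) / R) - θ * ((1 + ε) * s.card)) := by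
        rw [← hθR]
        exact hX.measureReal_exists_mem_spectrum_sum_le s θ _
    _ = Fintype.card ι * Real.exp (s.card / R * (ε - (1 + ε) * Real.log (1 + ε))) := by
        congr 2
        rw [hθ]
        ring
    _ ≤ Fintype.card ι * Real.exp (s.card / R * (-(ε ^ 2 / 3))) := by
        gcongr
        linarith [add_sq_div_three_le_mul_log hε hε1]
    _ = _ := by
        congr 2
        ring

theorem measureReal_lower_tail_le [IsProbabilityMeasure μ] [Nonempty ι]
    (hX : IsIsotropicFamily X R μ) (s : Finset κ) {ε : ℝ} (hε : 0 ≤ ε) :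
    μ.real {ω | ∃ r ∈ spectrum ℝ (∑ t ∈ s, X t ω), r ≤ (1 - ε) * s.card} ≤
      Fintype.card ι * Real.exp (-(ε ^ 2 * s.card / (2 * R))) := by
  have hR := hX.bound_pos
  set θ := -ε / R with hθ
  have hθR : θ * R = -ε := div_mul_cancel₀ _ hR.ne'
  have hθ0 : θ ≤ 0 := div_nonpos_of_nonpos_of_nonneg (neg_nonpos.2 hε) hR.le
  calc _ ≤ μ.real {ω | ∃ r ∈ spectrum ℝ (∑ t ∈ s, X t ω), θ * ((1 - ε) * s.card) ≤ θ * r} :=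
        measureReal_mono fun _ => Exists.imp fun _ => .imp_right (mul_le_mul_of_nonpos_left · hθ0)
    _ ≤ Fintype.card ι *
          Real.exp (s.card * ((Real.exp (-ε) - 1) / R) - θ * ((1 - ε) * s.card)) := by
        rw [← hθR]
        exact hX.measureReal_exists_mem_spectrum_sum_le s θ _
    _ = Fintype.card ι * Real.exp (s.card / R * (Real.exp (-ε) - 1 + ε * (1 - ε))) := by
        congr 2
        rw [hθ]
        ring
    _ ≤ Fintype.card ι * Real.exp (s.card / R * (-(ε ^ 2 / 2))) := by
        gcongr
        linarith [exp_neg_le_one_sub_add_sq_div_two hε]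
    _ = _ := by
        congr 2
        ring

/-- The **matrix Chernoff bound** for isotropic families. -/
theorem measureReal_not_spectrum_sum_subset_le [IsProbabilityMeasure μ] [Nonempty ι]
    (hX : IsIsotropicFamily X R μ) (s : Finset κ) {ε : ℝ} (hε : 0 ≤ ε) (hε1 : ε ≤ 1) :
    μ.real {ω | ¬spectrum ℝ (∑ t ∈ s, X t ω) ⊆
        Set.Ioo ((1 - ε) * s.card) ((1 + ε) * s.card)} ≤
      2 * Fintype.card ι * Real.exp (-(ε ^ 2 * s.card / (3 * R))) := by
  have hR := hX.bound_pos
  have hsub : {ω | ¬spectrum ℝ (∑ t ∈ s, X t ω) ⊆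
        Set.Ioo ((1 - ε) * s.card) ((1 + ε) * s.card)} ⊆
      {ω | ∃ r ∈ spectrum ℝ (∑ t ∈ s, X t ω), r ≤ (1 - ε) * s.card} ∪
        {ω | ∃ r ∈ spectrum ℝ (∑ t ∈ s, X t ω), (1 + ε) * s.card ≤ r} := by
    intro ω hω
    obtain ⟨r, hr, hnot⟩ := Set.not_subset.1 hω
    rcases not_and_or.1 hnot with hlow | hupp
    · exact .inl ⟨r, hr, not_lt.1 hlow⟩
    · exact .inr ⟨r, hr, not_lt.1 hupp⟩
  have hlower : Fintype.card ι * Real.exp (-(ε ^ 2 * s.card / (2 * R))) ≤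
      Fintype.card ι * Real.exp (-(ε ^ 2 * s.card / (3 * R))) := by
    gcongr
    norm_num
  calc _ ≤ _ := measureReal_mono hsub
    _ ≤ _ := measureReal_union_le _ _
    _ ≤ Fintype.card ι * Real.exp (-(ε ^ 2 * s.card / (3 * R))) +
        Fintype.card ι * Real.exp (-(ε ^ 2 * s.card / (3 * R))) :=
      add_le_add ((hX.measureReal_lower_tail_le s hε).trans hlower)
        (hX.measureReal_upper_tail_le s hε hε1)
    _ = _ := by ring

end IsIsotropicFamily

end MatrixChernoff

theorem spectrum_subset_pair_of_mul_self_eq_smul {𝕜 A : Type*} [Field 𝕜] [Ring A] [Algebra 𝕜 A]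
    {a : A} {c : 𝕜} (ha : a * a = c • a) : spectrum 𝕜 a ⊆ {0, c} := by
  nontriviality A
  intro r hr
  have hroot := spectrum.subset_polynomial_aeval a (.X * (.X - .C c)) ⟨r, hr, rfl⟩
  have haeval : Polynomial.aeval a (.X * (.X - .C c) : Polynomial 𝕜) = 0 := by
    simp [mul_sub, ha, ← Algebra.smul_def]
  have hzero : r * (r - c) = 0 := by
    rw [haeval, spectrum.zero_eq] at hroot
    simpa using hroot
  exact (mul_eq_zero.1 hzero).imp_right sub_eq_zero.1

theorem integral_Icc_exp_two_pi_mul_I (m : ℤ) :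
    ∫ t in Set.Icc (0 : ℝ) 1, Complex.exp (2 * Real.pi * Complex.I * m * t) =
      if m = 0 then 1 else 0 := by
  rw [integral_Icc_eq_integral_Ioc, ← intervalIntegral.integral_of_le zero_le_one]
  split_ifs with hm
  · simp [hm]
  · have hfreq : (2 * Real.pi * Complex.I * m : ℂ) ≠ 0 :=
      mul_ne_zero Complex.two_pi_I_ne_zero (Int.cast_ne_zero.2 hm)
    have hperiod : Complex.exp (2 * Real.pi * Complex.I * m) = 1 :=
      Complex.exp_eq_one_iff.2 ⟨m, mul_comm _ _⟩
    rw [integral_exp_mul_complex hfreq]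
    simp [hperiod]

theorem integral_Icc_prod_eq_prod_integral_Icc {ι 𝕜 : Type*} [Fintype ι] [RCLike 𝕜]
    (f : ι → ℝ → 𝕜) :
    ∫ y in Set.Icc (0 : ι → ℝ) 1, ∏ i, f i (y i) = ∏ i, ∫ t in Set.Icc (0 : ℝ) 1, f i t := by
  have hcube : Set.Icc (0 : ι → ℝ) 1 = Set.univ.pi fun _ => Set.Icc (0 : ℝ) 1 :=
    (Set.pi_univ_Icc _ _).symm
  rw [hcube, volume_pi, Measure.restrict_pi_pi, integral_fintype_prod_eq_prod]

namespace RandomFourier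

section Deterministic

open Matrix
open scoped Matrix.Norms.L2Operator

variable {ι : Type*} [Fintype ι] [DecidableEq ι] [Nonempty ι] {A : Matrix ι ι ℂ}

theorem spectrum_real_nonempty (hA : A.IsHermitian) : (spectrum ℝ A).Nonempty :=
  ⟨_, hA.eigenvalues_mem_spectrum_real (Classical.arbitrary ι)⟩

theorem lambda_bounds_of_spectrum_subset (hA : A.IsHermitian) {a b : ℝ}
    (hspec : spectrum ℝ A ⊆ Set.Ioo a b) :
    a < lambdaMin A ∧ lambdaMin A ≤ lambdaMax A ∧ lambdaMax A < b := by
  have hfin : (spectrum ℝ A).Finite := A.finite_real_spectrum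
  have hne := spectrum_real_nonempty hA
  exact ⟨(hspec (hne.csInf_mem hfin)).1, csInf_le_csSup hne hfin.bddBelow hfin.bddAbove,
    (hspec (hne.csSup_mem hfin)).2⟩

theorem opNorm_sub_one_lt_of_spectrum_subset (hA : A.IsHermitian) {ε : ℝ}
    (hspec : spectrum ℝ A ⊆ Set.Ioo (1 - ε) (1 + ε)) : opNorm (A - 1) < ε := by
  have hshift {r : ℝ} (hr : r ∈ spectrum ℝ (A - 1)) : r + 1 ∈ spectrum ℝ A := by
    rw [← map_one (algebraMap ℝ (Matrix ι ι ℂ)), ← spectrum.sub_singleton_eq] at hr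
    obtain ⟨s, hs, _, rfl, rfl⟩ := hr
    simpa using hs
  rw [opNorm, Matrix.l2_opNorm_toEuclideanCLM]
  rcases CStarAlgebra.norm_or_neg_norm_mem_spectrum (hA.sub isHermitian_one) with hpos | hneg
  · linarith [(hspec (hshift hpos)).2]
  · linarith [(hspec (hshift hneg)).1]

theorem condNumber_le_of_spectrum_subset (hA : A.IsHermitian) {a b : ℝ} (ha : 0 < a)
    (hspec : spectrum ℝ A ⊆ Set.Ioo a b) : condNumber A ≤ b / a := by
  obtain ⟨hmin, hle, hmax⟩ := lambda_bounds_of_spectrum_subset hA hspec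
  exact div_le_div₀ ((ha.trans hmin).le.trans (hle.trans hmax.le)) hmax.le ha hmin.le

variable {d n : ℕ} {Γ : Finset (Fin d → ℤ)} {x : Fin n → Fin d → ℝ}

theorem isHermitian_gram : (gram Γ x).IsHermitian :=
  isHermitian_conjTranspose_mul_self _

theorem normalizedGram_eq_real_smul : normalizedGram Γ x = (n : ℝ)⁻¹ • gram Γ x := by
  ext k l
  simp [normalizedGram]

theorem spectrum_normalizedGram_subset (hn : 0 < n) {a b : ℝ}
    (hspec : spectrum ℝ (gram Γ x) ⊆ Set.Ioo (a * n) (b * n)) :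
    spectrum ℝ (normalizedGram Γ x) ⊆ Set.Ioo a b := by
  have hn : (0 : ℝ) < n := Nat.cast_pos.2 hn
  intro r hr
  rw [normalizedGram_eq_real_smul] at hr
  have hscaled : r * n ∈ spectrum ℝ (gram Γ x) := by
    rw [mul_comm]
    exact (spectrum.smul_mem_smul_iff (r := (Units.mk0 (n : ℝ) hn.ne')⁻¹)).1
      (by simpa [Units.smul_def, hn.ne'] using hr)
  exact ⟨lt_of_mul_lt_mul_right (hspec hscaled).1 hn.le,
    lt_of_mul_lt_mul_right (hspec hscaled).2 hn.le⟩

theorem wellConditioned_of_spectrum_gram_subset (hΓ : Γ.Nonempty) {ε : ℝ} (hε1 : ε < 1)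
    (hspec : spectrum ℝ (gram Γ x) ⊆ Set.Ioo ((1 - ε) * n) ((1 + ε) * n)) :
    WellConditioned ε Γ x := by
  have : Nonempty Γ := hΓ.to_subtype
  have hn : 0 < n := by
    obtain ⟨r, hr⟩ := spectrum_real_nonempty (isHermitian_gram (Γ := Γ) (x := x))
    by_contra hn
    obtain rfl : n = 0 := by omega
    simpa using hspec hr
  have hn' : (0 : ℝ) < n := Nat.cast_pos.2 hn
  have hlow : 0 < (1 - ε) * n := mul_pos (sub_pos.2 hε1) hn'
  have hherm : (normalizedGram Γ x).IsHermitian :=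
    normalizedGram_eq_real_smul (Γ := Γ) (x := x) ▸ isHermitian_gram.smul (.all (n : ℝ)⁻¹)
  have hnorm := spectrum_normalizedGram_subset hn hspec
  refine ⟨opNorm_sub_one_lt_of_spectrum_subset hherm hnorm,
    lambda_bounds_of_spectrum_subset hherm hnorm,
    hlow.trans (lambda_bounds_of_spectrum_subset isHermitian_gram hspec).1, ?_⟩
  rw [← mul_div_mul_right (1 + ε) (1 - ε) hn'.ne']
  exact condNumber_le_of_spectrum_subset isHermitian_gram hlow hspec

end Deterministic

section RankOne

open Matrix
open scoped Matrix.Norms.L2Operator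

variable {d : ℕ} (Γ : Finset (Fin d → ℤ))

/-- The row of the Fourier matrix that belongs to the sampling point `y`. -/
noncomputable def fourierRow (y : Fin d → ℝ) : Γ → ℂ := fun k =>
  Complex.exp (2 * Real.pi * Complex.I * ((∑ i, ((k : Fin d → ℤ) i : ℝ) * y i : ℝ) : ℂ))

/-- The contribution of the sampling point `y` to the Gram matrix: the Gram matrix of a single row
of the Fourier matrix. -/
noncomputable def rankOneGram (y : Fin d → ℝ) : Matrix Γ Γ ℂ :=
  vecMulVec (star (fourierRow Γ y)) (fourierRow Γ y)

theorem gram_eq_sum_rankOneGram {n : ℕ} (x : Fin n → Fin d → ℝ) :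
    gram Γ x = ∑ t, rankOneGram Γ (x t) := by
  ext k l
  simp [gram, fourierMatrix, rankOneGram, fourierRow, Matrix.mul_apply, Matrix.sum_apply,
    vecMulVec_apply]

theorem isHermitian_rankOneGram (y : Fin d → ℝ) : (rankOneGram Γ y).IsHermitian := by
  rw [Matrix.IsHermitian, rankOneGram, conjTranspose_vecMulVec, star_star]

theorem continuous_rankOneGram : Continuous (rankOneGram Γ) := by
  have hrow : Continuous (fourierRow Γ) := by
    unfold fourierRow
    fun_prop
  exact hrow.star.matrix_vecMulVec hrow

theorem norm_fourierRow (y : Fin d → ℝ) (k : Γ) : ‖fourierRow Γ y k‖ = 1 := by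
  rw [fourierRow, Complex.norm_exp]
  simp

theorem rankOneGram_mul_self (y : Fin d → ℝ) :
    rankOneGram Γ y * rankOneGram Γ y = (Γ.card : ℝ) • rankOneGram Γ y := by
  have hnorm : fourierRow Γ y ⬝ᵥ star (fourierRow Γ y) = (Γ.card : ℂ) := by
    simp [dotProduct, Complex.mul_conj', norm_fourierRow]
  rw [rankOneGram, vecMulVec_mul_vecMulVec, hnorm, vecMulVec_smul]
  exact Nat.cast_smul_eq_nsmul ℂ _ _ |>.trans (Nat.cast_smul_eq_nsmul ℝ _ _).symm

theorem spectrum_rankOneGram_subset (y : Fin d → ℝ) :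
    spectrum ℝ (rankOneGram Γ y) ⊆ Set.Icc 0 (Γ.card : ℝ) := by
  refine (spectrum_subset_pair_of_mul_self_eq_smul (rankOneGram_mul_self Γ y)).trans ?_
  rintro r (rfl | rfl)
  · exact ⟨le_rfl, Nat.cast_nonneg _⟩
  · exact ⟨Nat.cast_nonneg _, le_rfl⟩

theorem rankOneGram_apply_eq_prod (y : Fin d → ℝ) (k l : Γ) : rankOneGram Γ y k l =
    ∏ i, Complex.exp (2 * Real.pi * Complex.I * ((l - k : Fin d → ℤ) i : ℤ) * y i) := by
  rw [rankOneGram, vecMulVec_apply, Pi.star_apply, fourierRow, fourierRow, RCLike.star_def,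
    ← Complex.exp_conj, ← Complex.exp_add, ← Complex.exp_sum]
  congr 1
  simp only [map_mul, map_ofNat, Complex.conj_ofReal, Complex.conj_I, Pi.sub_apply]
  push_cast
  simp only [Finset.mul_sum, ← Finset.sum_add_distrib]
  refine Finset.sum_congr rfl fun i _ => ?_
  ring

theorem integral_rankOneGram_apply (k l : Γ) :
    ∫ y in Set.Icc (0 : Fin d → ℝ) 1, rankOneGram Γ y k l = (1 : Matrix Γ Γ ℂ) k l := by
  simp_rw [rankOneGram_apply_eq_prod]
  rw [integral_Icc_prod_eq_prod_integral_Icc fun i (t : ℝ) =>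
    Complex.exp (2 * Real.pi * Complex.I * ((l - k : Fin d → ℤ) i : ℤ) * t)]
  simp_rw [integral_Icc_exp_two_pi_mul_I]
  rw [Finset.prod_ite_zero, Finset.prod_const_one, Matrix.one_apply]
  simp only [Finset.mem_univ, true_implies, Pi.sub_apply, sub_eq_zero, eq_comm (a := k),
    Subtype.ext_iff, funext_iff]

theorem integral_rankOneGram : ∫ y in Set.Icc (0 : Fin d → ℝ) 1, rankOneGram Γ y = 1 := by
  have hint : IntegrableOn (rankOneGram Γ) (Set.Icc 0 1) :=
    (continuous_rankOneGram Γ).continuousOn.integrableOn_compact isCompact_Icc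
  ext k l
  have hentry := (LinearMap.toContinuousLinearMap
    (Matrix.entryLinearMap ℝ ℂ k l)).integral_comp_comm hint
  exact hentry.symm.trans (integral_rankOneGram_apply Γ k l)

end RankOne

section Tail

open scoped Matrix.Norms.L2Operator

variable {d n : ℕ} {Γ : Finset (Fin d → ℤ)} {Ω : Type*} [MeasurableSpace Ω] {μ : Measure Ω}
  {x : Fin n → Ω → Fin d → ℝ}

theorem IsUniformSample.map_eq_restrict (hx : IsUniformSample μ x) (t : Fin n) :
    μ.map (x t) = volume.restrict (Set.Icc (0 : Fin d → ℝ) 1) := by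
  rw [hx.uniform t, ProbabilityTheory.cond]
  simp [Real.volume_Icc_pi]

theorem IsUniformSample.isIsotropicFamily_rankOneGram (hx : IsUniformSample μ x)
    (hΓ : Γ.Nonempty) [MeasurableSpace (Matrix Γ Γ ℂ)] [BorelSpace (Matrix Γ Γ ℂ)] :
    IsIsotropicFamily (fun t ω => rankOneGram Γ (x t ω)) Γ.card μ where
  measurable t := (continuous_rankOneGram Γ).measurable.comp (hx.measurable t)
  indep := hx.indep.comp (fun _ => rankOneGram Γ) fun _ => (continuous_rankOneGram Γ).measurable
  isHermitian _ _ := isHermitian_rankOneGram Γ _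
  bound_pos := Nat.cast_pos.2 hΓ.card_pos
  spectrum_subset _ _ := spectrum_rankOneGram_subset Γ _
  integral_eq_one t := by
    rw [← integral_map (hx.measurable t).aemeasurable
      (continuous_rankOneGram Γ).aestronglyMeasurable, hx.map_eq_restrict, integral_rankOneGram]

theorem IsUniformSample.measureReal_not_wellConditioned_le [IsProbabilityMeasure μ]
    (hx : IsUniformSample μ x) (hΓ : Γ.Nonempty) {ε : ℝ} (hε : 0 ≤ ε) (hε1 : ε < 1) :
    μ.real {ω | ¬WellConditioned ε Γ fun t => x t ω} ≤
      2 * Γ.card * Real.exp (-(ε ^ 2 * n / (3 * Γ.card))) := by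
  borelize (Matrix Γ Γ ℂ)
  have : Nonempty Γ := hΓ.to_subtype
  have hchernoff := (hx.isIsotropicFamily_rankOneGram hΓ).measureReal_not_spectrum_sum_subset_le
    Finset.univ hε hε1.le
  simp only [← gram_eq_sum_rankOneGram, Finset.card_univ, Fintype.card_fin, Fintype.card_coe]
    at hchernoff
  exact (measureReal_mono fun ω => mt (wellConditioned_of_spectrum_gram_subset hΓ hε1)).trans
    hchernoff

theorem IsUniformSample.one_sub_le_measureReal_wellConditioned [IsProbabilityMeasure μ]
    (hx : IsUniformSample μ x) (hΓ : Γ.Nonempty) {ε δ : ℝ} (hε : 0 ≤ ε) (hε1 : ε < 1) (hδ : 0 < δ)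
    (hn : Real.log 2 + Real.log (Γ.card / δ) ≤ ε ^ 2 * n / (3 * Γ.card)) :
    1 - δ ≤ μ.real {ω | WellConditioned ε Γ fun t => x t ω} := by
  have hD : (0 : ℝ) < Γ.card := Nat.cast_pos.2 hΓ.card_pos
  have hfail : μ.real {ω | ¬WellConditioned ε Γ fun t => x t ω} ≤ δ :=
    calc _ ≤ 2 * Γ.card * Real.exp (-(ε ^ 2 * n / (3 * Γ.card))) :=
          hx.measureReal_not_wellConditioned_le hΓ hε hε1
      _ ≤ 2 * Γ.card * Real.exp (-(Real.log 2 + Real.log (Γ.card / δ))) := by gcongr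
      _ = δ := by
          rw [← Real.log_mul two_ne_zero (div_pos hD hδ).ne', Real.exp_neg,
            Real.exp_log (mul_pos two_pos (div_pos hD hδ))]
          field_simp
  have hcover : 1 ≤ μ.real {ω | WellConditioned ε Γ fun t => x t ω} +
      μ.real {ω | ¬WellConditioned ε Γ fun t => x t ω} := by
    rw [← probReal_univ (μ := μ), ← Set.union_compl_self {ω | WellConditioned ε Γ fun t => x t ω}]
    exact measureReal_union_le _ _
  linarith

end Tail

section SampleSize

variable {ε δ D n : ℝ}

theorem log_two_add_log_div_le_of_floor (hε1 : ε ^ 2 < 1) (hδ : 0 < δ) (hδ1 : δ < 1) (hD : 1 ≤ D)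
    {α : ℝ} (hα : 0 < α) (hαε : α < ε ^ 2)
    (hn : (Real.log (ε ^ 2 / α))⁻¹ * Real.log (D / (δ * (1 - α))) ≤ ⌊α * n / (3 * D)⌋) :
    Real.log 2 + Real.log (D / δ) ≤ ε ^ 2 * n / (3 * D) := by
  set r := ε ^ 2 / α with hr
  set N := ⌊α * n / (3 * D)⌋
  have hr1 : 1 < r := (one_lt_div hα).2 hαε
  have hlogr : 0 < Real.log r := Real.log_pos hr1
  have hα1 : 0 < 1 - α := by linarith
  have hshrink : δ * (1 - α) < δ := mul_lt_of_lt_one_right hδ (by linarith)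
  have hlog_pos : 0 < Real.log (D / (δ * (1 - α))) :=
    Real.log_pos ((one_lt_div (by positivity)).2 (by linarith))
  have hlog_mono : Real.log (D / δ) ≤ Real.log (D / (δ * (1 - α))) := by gcongr
  have hN : (1 : ℝ) ≤ N := by
    have hN0 : (0 : ℝ) < N := (by positivity : 0 < (Real.log r)⁻¹ * _).trans_le hn
    exact_mod_cast hN0
  have hlogN : Real.log (D / (δ * (1 - α))) ≤ N * Real.log r := by
    rwa [inv_mul_le_iff₀ hlogr, mul_comm (Real.log r)] at hn
  calc Real.log 2 + Real.log (D / δ) ≤ N + N * Real.log r := by linarith [Real.log_two_lt_d9]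
    _ = (1 + Real.log r) * N := by ring
    _ ≤ r * (α * n / (3 * D)) := by
        gcongr
        · linarith [Real.log_le_sub_one_of_pos (zero_lt_one.trans hr1)]
        · exact Int.floor_le _
    _ = ε ^ 2 * n / (3 * D) := by
        rw [hr]
        field_simp

theorem log_two_add_log_div_le_of_exp_one_mul (hε : 0 < ε) (hδ : 0 < δ) (hδ1 : δ ≤ 1) (hD : 1 ≤ D)
    (hn : 3 * D * Real.exp 1 / ε ^ 2 * (Real.log (D / δ) + 2 - Real.log (Real.exp 1 - 1)) ≤ n) :
    Real.log 2 + Real.log (D / δ) ≤ ε ^ 2 * n / (3 * D) := by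
  have he := Real.exp_one_gt_d9
  have hlog : 0 ≤ Real.log (D / δ) := Real.log_nonneg ((one_le_div hδ).2 (hδ1.trans hD))
  have hlog_e : Real.log (Real.exp 1 - 1) ≤ 1 := by
    rw [Real.log_le_iff_le_exp (by linarith)]
    linarith
  calc Real.log 2 + Real.log (D / δ) ≤ Real.exp 1 * (Real.log (D / δ) + 1) := by
        nlinarith [Real.log_two_lt_d9]
    _ ≤ Real.exp 1 * (Real.log (D / δ) + 2 - Real.log (Real.exp 1 - 1)) := by
        gcongr
        linarith
    _ = ε ^ 2 * (3 * D * Real.exp 1 / ε ^ 2 *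
          (Real.log (D / δ) + 2 - Real.log (Real.exp 1 - 1))) / (3 * D) := by
        field_simp
    _ ≤ ε ^ 2 * n / (3 * D) := by gcongr

theorem log_two_add_log_div_le_of_mul_log (hε : 0 < ε) (hδ : 0 < δ) (hD : 2 ≤ D)
    (hn : 3 / ε ^ 2 * (2 + |Real.log δ| / Real.log 2) * (D * Real.log D) ≤ n) :
    Real.log 2 + Real.log (D / δ) ≤ ε ^ 2 * n / (3 * D) := by
  have hlog2 : 0 < Real.log 2 := Real.log_pos one_lt_two
  have hD0 : 0 < D := two_pos.trans_le hD
  have hlogD : Real.log 2 ≤ Real.log D := Real.log_le_log two_pos hD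
  have hlogδ : |Real.log δ| ≤ |Real.log δ| / Real.log 2 * Real.log D := by
    rw [div_mul_eq_mul_div, le_div_iff₀ hlog2]
    gcongr
  calc Real.log 2 + Real.log (D / δ) ≤ (2 + |Real.log δ| / Real.log 2) * Real.log D := by
        rw [Real.log_div hD0.ne' hδ.ne']
        linarith [neg_abs_le (Real.log δ)]
    _ = ε ^ 2 * (3 / ε ^ 2 * (2 + |Real.log δ| / Real.log 2) * (D * Real.log D)) / (3 * D) := by
        field_simp
    _ ≤ ε ^ 2 * n / (3 * D) := by gcongr

end SampleSize

end RandomFourier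

open RandomFourier in
theorem mainTheorem1 (ε δ : ℝ) (hε : 0 < ε) (hε1 : ε < 1) (hδ : 0 < δ) :
    ∃ C : ℝ, 0 < C ∧
      ∀ (d n : ℕ) (Γ : Finset (Fin d → ℤ)), Γ.Nonempty →
      ∀ (Ω : Type*) [MeasurableSpace Ω] (μ : Measure Ω) [IsProbabilityMeasure μ]
        (x : Fin n → Ω → Fin d → ℝ), RandomFourier.IsUniformSample μ x →
        (∀ α : ℝ, 0 < α → α < ε ^ 2 →
          ((⌊α * (n : ℝ) / (3 * (Γ.card : ℝ))⌋ : ℤ) : ℝ) ≥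
            (Real.log (ε ^ 2 / α))⁻¹ * Real.log ((Γ.card : ℝ) / (δ * (1 - α))) →
          μ.real {ω | RandomFourier.WellConditioned ε Γ (fun t => x t ω)} ≥ 1 - δ) ∧
        ((n : ℝ) ≥ 3 * (Γ.card : ℝ) * Real.exp 1 / ε ^ 2 *
            (Real.log ((Γ.card : ℝ) / δ) + 2 - Real.log (Real.exp 1 - 1)) →
          μ.real {ω | RandomFourier.WellConditioned ε Γ (fun t => x t ω)} ≥ 1 - δ) ∧
        (2 ≤ Γ.card → (n : ℝ) ≥ C * ((Γ.card : ℝ) * Real.log (Γ.card : ℝ)) →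
          μ.real {ω | RandomFourier.WellConditioned ε Γ (fun t => x t ω)} ≥ 1 - δ) := by
  refine ⟨3 / ε ^ 2 * (2 + |Real.log δ| / Real.log 2), by positivity, ?_⟩
  intro d n Γ hΓ Ω _ μ _ x hx
  rcases le_or_gt 1 δ with hδ1 | hδ1
  · have htrivial : 1 - δ ≤ μ.real {ω | WellConditioned ε Γ fun t => x t ω} :=
      (sub_nonpos.2 hδ1).trans measureReal_nonneg
    exact ⟨fun _ _ _ _ => htrivial, fun _ => htrivial, fun _ _ => htrivial⟩
  have hD : (1 : ℝ) ≤ Γ.card := Nat.one_le_cast.2 hΓ.card_pos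
  have hsuff := hx.one_sub_le_measureReal_wellConditioned hΓ hε.le hε1 hδ
  refine ⟨fun α hα hαε hn => hsuff ?_, fun hn => hsuff ?_, fun hD2 hn => hsuff ?_⟩
  · exact log_two_add_log_div_le_of_floor (pow_lt_one₀ hε.le hε1 two_ne_zero) hδ hδ1 hD hα hαε hn
  · exact log_two_add_log_div_le_of_exp_one_mul hε hδ hδ1.le hD hn
  · exact log_two_add_log_div_le_of_mul_log hε hδ (by exact_mod_cast hD2) hn
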